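/- Hypergraphs on the vertex set $[n]$ are finite and may have parallel hyperedges. For a $q$-uniform hypergraph $\mathcal H$ on $[n]$, the average degree is the average over $v\in[n]$ of the number of hyperedges containing $v$. For $Q\subseteq[n]$ the co-degree of $Q$ is the number of hyperedges containing $Q$, and $d_r$ is the maximum co-degree of an $r$-element subset of $[n]$, so that $d_1\ge d_2\ge\dots\ge d_q$. For $t\in[q]$, the hypergraph $\mathcal H$ is called *$t$-approximately strongly regular* if the following hold. (a) The hyperedges can be partitioned as $\mathcal H=\mathcal H_1\sqcup\dots\sqcup\mathcal H_p$ such that for every $\theta\in[p]$ there is a $t$-element set $Q_\theta\subseteq[n]$ contained in every hyperedge of $\mathcal H_\theta$, and $d_t/2\le|\mathcal H_\theta|\le d_t$. (b) The index $t$ is good with respect to $(d_1,\dots,d_q)$, that is: 1. $d_r/d_t\le n^{1-\frac{2r}{q}}$ for every $1\le r\le\lceil\frac{q-t}{2}\rceil$; 2. $d_r/d_t\le n^{-\frac2q(r-t)+\frac1q(t-\mathbf 1(t\text{ even}))}$ for every $t\le r\le\lfloor\frac{q+t}{2}\rfloor$; 3. if $t<q/2$, then $d_t\ge d_1 n^{-\frac2q(t-1)}$,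 and if $t>q/2$, then $d_t\ge d_1n^{-1+\frac2q}$. A coloring of the hyperedges is *proper* if the hyperedges containing any given vertex have pairwise distinct colors. An *even cover* is a set of hyperedges that contains every vertex an even number of times, and it is *weakly rainbow* if some color occurs on exactly one of its hyperedges. **Lemma.** Let $q\in\mathbb N$ be odd. There is a constant $A>0$ depending only on $q$ such that the following holds for every $t\in[q]$ and every $n\ge2$. Let $\mathcal H$ be a properly hyperedge-colored, $q$-uniform, $t$-approximately strongly regular hypergraph on $[n]$ with average degree at least $A\,n^{1-\frac2q}\log n$. Then $\mathcal H$ contains a weakly rainbow even cover. -/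

import Mathlib

/-- A finite hypergraph on the vertex set `[n]` with hyperedges indexed by `E`. Distinct indices may
carry the same vertex set, so parallel hyperedges are allowed. -/
structure MultiHypergraph (n : ℕ) (E : Type*) where
  /-- the set of vertices of a hyperedge -/
  verts : E → Finset (Fin n)

namespace MultiHypergraph

variable {n : ℕ} {E : Type*}

/-- Every hyperedge has exactly `q` vertices. -/
def IsUniform (H : MultiHypergraph n E) (q : ℕ) : Prop :=
  ∀ e, (H.verts e).card = q

/-- The hyperedges incident to any given vertex have pairwise distinct colors. -/
def IsProperColoring (H : MultiHypergraph n E) {κ : Type*} (color : E → κ) : Prop :=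
  ∀ v : Fin n, ∀ e f : E, v ∈ H.verts e → v ∈ H.verts f → e ≠ f → color e ≠ color f

/-- A set of hyperedges that covers every vertex an even number of times. -/
def IsEvenCover (H : MultiHypergraph n E) (S : Finset E) : Prop :=
  ∀ v : Fin n, Even (S.filter (fun e => v ∈ H.verts e)).card

/-- An even cover that uses exactly one hyperedge of some color. -/
def IsWeaklyRainbowEvenCover (H : MultiHypergraph n E) {κ : Type*} (color : E → κ)
    (S : Finset E) : Prop :=
  H.IsEvenCover S ∧ ∃ c : κ, ∃! e : E, e ∈ S ∧ color e = c

variable [Fintype E]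

/-- The number of hyperedges containing the vertex `v`. -/
def degree (H : MultiHypergraph n E) (v : Fin n) : ℕ :=
  (Finset.univ.filter (fun e : E => v ∈ H.verts e)).card

/-- The average of the vertex degrees. -/
noncomputable def avgDegree (H : MultiHypergraph n E) : ℝ :=
  (∑ v : Fin n, (H.degree v : ℝ)) / n

/-- The number of hyperedges containing the set `Q`. -/
def codegree (H : MultiHypergraph n E) (Q : Finset (Fin n)) : ℕ :=
  (Finset.univ.filter (fun e : E => Q ⊆ H.verts e)).card

/-- The maximal co-degree `d_r` of a set of `r` vertices. -/
def maxCodegree (H : MultiHypergraph n E) (r : ℕ) : ℕ :=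
  (Finset.powersetCard r (Finset.univ : Finset (Fin n))).sup H.codegree

end MultiHypergraph

/-- `t ∈ {1, …, q}` is a good index for the sequence `d 1 ≥ d 2 ≥ ⋯ ≥ d q` (with parameter `n`).
For `t ≤ q` the natural number `(q - t + 1) / 2` is `⌈(q - t) / 2⌉`, and `(q + t) / 2` is
`⌊(q + t) / 2⌋`. -/
def IsGoodIndex (n q : ℕ) (d : ℕ → ℝ) (t : ℕ) : Prop :=
  (∀ r : ℕ, 1 ≤ r → r ≤ (q - t + 1) / 2 →
    d r / d t ≤ (n : ℝ) ^ (1 - 2 * (r : ℝ) / q)) ∧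
  (∀ r : ℕ, t ≤ r → r ≤ (q + t) / 2 →
    d r / d t ≤
      (n : ℝ) ^ (-(2 / (q : ℝ)) * ((r : ℝ) - t) + 1 / (q : ℝ) * ((t : ℝ) - if Even t then 1 else 0))) ∧
  ((t : ℝ) < (q : ℝ) / 2 → d t ≥ d 1 * (n : ℝ) ^ (-(2 / (q : ℝ)) * ((t : ℝ) - 1))) ∧
  ((t : ℝ) > (q : ℝ) / 2 → d t ≥ d 1 * (n : ℝ) ^ (-1 + 2 / (q : ℝ)))

/-- `t`-approximate strong regularity of a `q`-uniform hypergraph. The hyperedges are partitioned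
into the fibers of `part`, one for each `θ`, and the hyperedges of the part `θ` all contain the
`t`-set `Q θ`. -/
def MultiHypergraph.IsApproxStronglyRegular {n : ℕ} {E : Type*} [Fintype E]
    (H : MultiHypergraph n E) (q t : ℕ) : Prop :=
  (∃ (p : ℕ) (part : E → Fin p) (Q : Fin p → Finset (Fin n)),
    (∀ θ, (Q θ).card = t) ∧
    (∀ e, Q (part e) ⊆ H.verts e) ∧
    (∀ θ, (H.maxCodegree t : ℝ) / 2 ≤ ((Finset.univ.filter (fun e => part e = θ)).card : ℝ) ∧
      (Finset.univ.filter (fun e => part e = θ)).card ≤ H.maxCodegree t)) ∧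
  IsGoodIndex n q (fun r => (H.maxCodegree r : ℝ)) t

/-! Suppose there is no weakly rainbow even cover. Then over the two-element field no incidence
vector of a hyperedge lies in the span of those of the other colors
(`exists_weaklyRainbow_of_mem_otherSpan`).

Consider a Kikuchi-type graph. Its points are families of `a + b = q - t` words of length `L` over
`[n]`, with `a` and `b` the two halves of `q - t` rounded up and down. A pair `X`, `Y` from one star
gives an edge at each choice of positions: half of `X` and half of `Y` are replaced by the
complementary halves. The common center cancels modulo 2, so the potential changes by the sum of the
two incidence vectors. For a color `c` of an edge, the points whose potential lies in a fixed coset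
of the span of the other colors form a cut that separates its ends and is crossed only by edges
involving `c`. If color degrees are at most `D`, recursive cutting leaves at most `2 D N log₂ N`
oriented edges on `N` points (`sum_weight_le_of_cuts`, `card_good_le`).

Goodness of `t` bounds the average color degree over the points matched by any given label
(`sum_colorDegree_le`). By Markov half of the edges involve only colors of small degree at both ends
(`card_incidences_le`). Hence there are `O(n d_t L log n)` pairs in common stars, whereas the stars
supply at least `|E| d_t / 4`. With `L` about `n^(1-2/q)` this contradicts the average degree. -/

/-! ### Edge isoperimetry from cuts. -/

section Isoperimetry

/-- Splitting a vertex set in two parts gains at least the size of the smaller part. -/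
lemma mul_logb_add_mul_logb_add_min_le {a b : ℝ} (ha : 1 ≤ a) (hb : 1 ≤ b) :
    a * Real.logb 2 a + b * Real.logb 2 b + min a b ≤ (a + b) * Real.logb 2 (a + b) := by
  wlog h : a ≤ b generalizing a b
  · have := this hb ha (le_of_not_ge h)
    rw [min_comm, add_comm a b]
    linarith
  rw [min_eq_left h]
  -- Joining at least doubles the smaller part, so its logarithm grows by at least one.
  have h1 : Real.logb 2 a + 1 ≤ Real.logb 2 (a + b) := by
    have : Real.logb 2 (2 * a) = Real.logb 2 a + 1 := by
      rw [Real.logb_mul (by norm_num) (by positivity), Real.logb_self_eq_one (by norm_num)]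
      ring
    rw [← this]
    exact Real.logb_le_logb_of_le (by norm_num) (by positivity) (by linarith)
  have h2 : Real.logb 2 b ≤ Real.logb 2 (a + b) :=
    Real.logb_le_logb_of_le (by norm_num) (by positivity) (by linarith)
  nlinarith

/-- A weighted graph in which every edge is separated by a cut with at most `D` crossing weight at
each vertex has total weight at most `2 D N log₂ N`. -/
theorem sum_weight_le_of_cuts {V : Type*} [DecidableEq V] (w : V → V → ℝ)
    (hsymm : ∀ x y, w x y = w y x) {D : ℝ} (hD : 0 ≤ D)
    (hcut : ∀ x y, w x y ≠ 0 → ∃ U : V → Prop, U x ∧ ¬ U y ∧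
      ∀ v, ∀ T : Finset V, (∀ u ∈ T, ¬ (U u ↔ U v)) → ∑ u ∈ T, w v u ≤ D)
    (W : Finset V) :
    ∑ x ∈ W, ∑ y ∈ W, w x y ≤ 2 * D * (W.card * Real.logb 2 W.card) := by
  classical
  induction W using Finset.strongInduction with
  | H W ih =>
  by_cases h0 : ∀ x ∈ W, ∀ y ∈ W, w x y = 0
  · rw [Finset.sum_eq_zero fun x hx => Finset.sum_eq_zero fun y hy => h0 x hx y hy]
    rcases W.eq_empty_or_nonempty with rfl | hne
    · simp
    · obtain ⟨x, hx⟩ := hne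
      have : (1 : ℝ) ≤ W.card := by exact_mod_cast Finset.card_pos.2 ⟨x, hx⟩
      have := Real.logb_nonneg (b := 2) (by norm_num) this
      positivity
  · push Not at h0
    obtain ⟨x, hx, y, hy, hxy⟩ := h0
    obtain ⟨U, hUx, hUy, hU⟩ := hcut x y hxy
    set W1 := W.filter U with hW1
    set W2 := W.filter (fun v => ¬ U v) with hW2
    have hx1 : x ∈ W1 := by simp [hW1, hx, hUx]
    have hy2 : y ∈ W2 := by simp [hW2, hy, hUy]
    have hs1 : W1 ⊂ W := Finset.filter_ssubset.2 ⟨y, hy, hUy⟩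
    have hs2 : W2 ⊂ W := Finset.filter_ssubset.2 ⟨x, hx, by simpa using hUx⟩
    have i1 := ih W1 hs1
    have i2 := ih W2 hs2
    have c12 : ∑ v ∈ W1, ∑ u ∈ W2, w v u ≤ W1.card * D := by
      rw [← nsmul_eq_mul]
      refine Finset.sum_le_card_nsmul _ _ _ fun v hv => hU v W2 ?_
      intro u hu
      simp only [hW1, hW2, Finset.mem_filter] at hu hv
      tauto
    have c21 : ∑ v ∈ W2, ∑ u ∈ W1, w v u ≤ W2.card * D := by
      rw [← nsmul_eq_mul]
      refine Finset.sum_le_card_nsmul _ _ _ fun v hv => hU v W1 ?_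
      intro u hu
      simp only [hW1, hW2, Finset.mem_filter] at hu hv
      tauto
    have hcomm : ∑ v ∈ W2, ∑ u ∈ W1, w v u = ∑ v ∈ W1, ∑ u ∈ W2, w v u := by
      rw [Finset.sum_comm]
      exact Finset.sum_congr rfl fun _ _ => Finset.sum_congr rfl fun _ _ => hsymm _ _
    have hsplit : ∑ x ∈ W, ∑ y ∈ W, w x y = (∑ x ∈ W1, ∑ y ∈ W1, w x y) +
        (∑ x ∈ W2, ∑ y ∈ W2, w x y) + 2 * ∑ v ∈ W1, ∑ u ∈ W2, w v u := by
      have hin : ∀ f : V → ℝ, ∑ y ∈ W, f y = ∑ y ∈ W1, f y + ∑ y ∈ W2, f y := fun f =>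
        (Finset.sum_filter_add_sum_filter_not W U f).symm
      rw [hin]
      simp_rw [hin, Finset.sum_add_distrib]
      rw [hcomm]
      ring
    have hcard : (W.card : ℝ) = W1.card + W2.card := by
      rw [← Finset.card_filter_add_card_filter_not (s := W) U]
      push_cast; rfl
    -- The crossing weight can be counted from either side of the cut; the resulting minimum is paid
    -- for by the entropy gain of the split.
    have hmin : ∑ v ∈ W1, ∑ u ∈ W2, w v u ≤ D * min (W1.card : ℝ) W2.card := by
      rw [mul_min_of_nonneg _ _ hD, le_min_iff]
      constructor <;> linarith
    have key := mul_logb_add_mul_logb_add_min_le (a := W1.card) (b := W2.card)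
      (by exact_mod_cast Finset.card_pos.2 ⟨x, hx1⟩) (by exact_mod_cast Finset.card_pos.2 ⟨y, hy2⟩)
    rw [hsplit, hcard]
    have := mul_le_mul_of_nonneg_left key (by positivity : 0 ≤ 2 * D)
    linarith

end Isoperimetry

/-! ### Counting words with prescribed letters. -/

section ProductSpace

/-- The number of words of length `L` over `[n]` with one prescribed letter. -/
lemma card_filter_apply_eq {n L : ℕ} (p : Fin L) (z : Fin n) :
    (Finset.univ.filter fun f : Fin L → Fin n => f p = z).card = n ^ (L - 1) := by
  classical
  have : (Finset.univ.filter fun f : Fin L → Fin n => f p = z) =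
      Fintype.piFinset (fun k => if k = p then {z} else Finset.univ) := by
    ext f
    simp only [Finset.mem_filter, Finset.mem_univ, true_and, Fintype.mem_piFinset]
    constructor
    · rintro rfl k
      split_ifs with h
      · simp [h]
      · simp
    · intro h
      simpa using h p
  rw [this, Fintype.card_piFinset, ← Finset.mul_prod_erase _ _ (Finset.mem_univ p)]
  rw [Finset.prod_congr rfl (g := fun _ => n)]
  · simp
  · intro k hk
    simp [Finset.ne_of_mem_erase hk]

/-- The number of words of length `L` over `[n]` with two prescribed letters. -/
lemma card_filter_apply_eq_and {n L : ℕ} {p p' : Fin L} (hp : p' ≠ p) (z z' : Fin n) :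
    (Finset.univ.filter fun f : Fin L → Fin n => f p = z ∧ f p' = z').card = n ^ (L - 2) := by
  classical
  have : (Finset.univ.filter fun f : Fin L → Fin n => f p = z ∧ f p' = z') =
      Fintype.piFinset (fun k => if k = p then {z} else if k = p' then {z'} else Finset.univ) := by
    ext f
    simp only [Finset.mem_filter, Finset.mem_univ, true_and, Fintype.mem_piFinset]
    constructor
    · rintro ⟨rfl, rfl⟩ k
      split_ifs with h h'
      · simp [h]
      · simp [h']
      · simp
    · intro h
      exact ⟨by simpa using h p, by simpa [hp] using h p'⟩
  rw [this, Fintype.card_piFinset, ← Finset.mul_prod_erase _ _ (Finset.mem_univ p),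
    ← Finset.mul_prod_erase _ _ (Finset.mem_erase.2 ⟨hp, Finset.mem_univ p'⟩)]
  rw [Finset.prod_congr rfl (g := fun _ => n)]
  · simp [hp, Finset.card_erase_of_mem, Nat.sub_sub]
  · intro k hk
    simp only [Finset.mem_erase] at hk
    simp [hk.1, hk.2.1]

/-- The position `p' = p` contributes only if the letters agree; each of the fewer than `L` other
positions costs a factor `1 / n`. -/
lemma sum_card_filter_apply_eq_and_le {n L : ℕ} (hn : 0 < n) (p : Fin L) (z z' : Fin n) :
    ∑ p' : Fin L, ((Finset.univ.filter fun f : Fin L → Fin n => f p = z ∧ f p' = z').card : ℝ) ≤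
      (n : ℝ) ^ (L - 1) * ((if z' = z then 1 else 0) + (L : ℝ) / n) := by
  classical
  rw [← Finset.add_sum_erase _ _ (Finset.mem_univ p), mul_add]
  refine add_le_add ?_ ?_
  · split_ifs with h
    · subst h
      simp only [and_self, card_filter_apply_eq]
      simp
    · rw [Finset.card_eq_zero.2]
      · simp
      · rw [Finset.filter_eq_empty_iff]
        rintro f - ⟨rfl, rfl⟩
        exact h rfl
  · have hn' : (0 : ℝ) < n := by exact_mod_cast hn
    calc _ ≤ ∑ p' ∈ Finset.univ.erase p, (n : ℝ) ^ (L - 1) / n := by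
          refine Finset.sum_le_sum fun p' hp' => ?_
          have hne := Finset.ne_of_mem_erase hp'
          -- Two distinct positions force `L ≥ 2`, so the truncated subtraction is exact.
          have hL : L - 1 = (L - 2) + 1 := by
            have := p.2; have := p'.2
            have : (p' : ℕ) ≠ p := fun h => hne (Fin.ext h)
            omega
          rw [card_filter_apply_eq_and hne, hL, pow_succ]
          push_cast
          rw [mul_div_assoc, div_self hn'.ne', mul_one]
      _ ≤ L * ((n : ℝ) ^ (L - 1) / n) := by
          rw [Finset.sum_const, nsmul_eq_mul]
          gcongr
          simp
      _ = _ := by ring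

variable {ι : Type*} [Fintype ι] [DecidableEq ι] {n L : ℕ}

lemma card_filter_forall_apply_eq (p : ι → Fin L) (z : ι → Fin n) :
    (Finset.univ.filter fun x : ι → Fin L → Fin n => ∀ i, x i (p i) = z i).card =
      (n ^ (L - 1)) ^ Fintype.card ι := by
  have : (Finset.univ.filter fun x : ι → Fin L → Fin n => ∀ i, x i (p i) = z i) =
      Fintype.piFinset fun i => Finset.univ.filter fun f : Fin L → Fin n => f (p i) = z i := by
    ext x
    simp
  rw [this, Fintype.card_piFinset]
  simp [card_filter_apply_eq]

/-- The expected number of position vectors `p'` at which a random `x` with prescribed letters `z`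
at the positions `p` has the letters `z'`. -/
lemma sum_card_filter_forall_and_le (hn : 0 < n) (p : ι → Fin L) (z z' : ι → Fin n) :
    ∑ p' : ι → Fin L, ((Finset.univ.filter fun x : ι → Fin L → Fin n =>
        (∀ i, x i (p i) = z i) ∧ ∀ i, x i (p' i) = z' i).card : ℝ) ≤
      ((n : ℝ) ^ (L - 1)) ^ Fintype.card ι *
        ∑ I : Finset ι, if ∀ i ∈ I, z' i = z i then ((L : ℝ) / n) ^ (Fintype.card ι - I.card)
          else 0 := by
  have h1 : ∀ p' : ι → Fin L, ((Finset.univ.filter fun x : ι → Fin L → Fin n =>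
        (∀ i, x i (p i) = z i) ∧ ∀ i, x i (p' i) = z' i).card : ℝ) =
      ∏ i, ((Finset.univ.filter fun f : Fin L → Fin n =>
        f (p i) = z i ∧ f (p' i) = z' i).card : ℝ) := by
    intro p'
    rw [← Nat.cast_prod, ← Fintype.card_piFinset]
    congr 2
    ext x
    simp [forall_and]
  simp_rw [h1]
  rw [← Fintype.piFinset_univ, Finset.sum_prod_piFinset Finset.univ (fun i j =>
    ((Finset.univ.filter fun f : Fin L → Fin n => f (p i) = z i ∧ f j = z' i).card : ℝ))]
  calc _ ≤ ∏ i, ((n : ℝ) ^ (L - 1) * ((if z' i = z i then 1 else 0) + (L : ℝ) / n)) :=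
        Finset.prod_le_prod (fun i _ => by positivity)
          fun i _ => sum_card_filter_apply_eq_and_le hn (p i) (z i) (z' i)
    _ = _ := by
        -- In the expanded product, `I` collects the coordinates where the coincidence term is
        -- chosen.
        rw [Finset.prod_mul_distrib, Finset.prod_const, Finset.card_univ, Fintype.prod_add]
        congr 1
        refine Finset.sum_congr rfl fun I _ => ?_
        rw [Finset.prod_const, Finset.card_compl, Finset.prod_ite_zero]
        split_ifs <;> simp

end ProductSpace

/-! ### Star partitions and co-degrees. -/

namespace MultiHypergraph

variable {n : ℕ} {E κ : Type*}

/-- A partition of the hyperedges into stars, where all the hyperedges of a star contain its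
`t`-element center, together with enumerations by `ι` of the hyperedges outside the centers. -/
structure StarPartition (H : MultiHypergraph n E) (t : ℕ) (ι : Type*) [Fintype ι] where
  /-- the number of stars -/
  stars : ℕ
  /-- the star of a hyperedge -/
  part : E → Fin stars
  /-- the center of a star -/
  center : Fin stars → Finset (Fin n)
  card_center : ∀ θ, (center θ).card = t
  center_subset : ∀ e, center (part e) ⊆ H.verts e
  /-- an enumeration of the vertices outside the center -/
  enum : E → ι → Fin n
  enum_injective : ∀ e, Function.Injective (enum e)
  image_enum : ∀ e, Finset.univ.image (enum e) = H.verts e \ center (part e)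

section Codegree

variable [Fintype E] (H : MultiHypergraph n E)

lemma codegree_le_maxCodegree (Q : Finset (Fin n)) : H.codegree Q ≤ H.maxCodegree Q.card :=
  Finset.le_sup (f := H.codegree) (by simp)

lemma maxCodegree_succ_le (r : ℕ) : H.maxCodegree (r + 1) ≤ H.maxCodegree r := by
  refine Finset.sup_le fun Q hQ => ?_
  rw [Finset.mem_powersetCard] at hQ
  obtain ⟨R, hR, hc⟩ := Finset.exists_subset_card_eq (s := Q) (n := r) (by omega)
  refine le_trans ?_ (hc ▸ H.codegree_le_maxCodegree R)
  exact Finset.card_le_card fun e he => by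
    simp only [Finset.mem_filter, Finset.mem_univ, true_and] at he ⊢
    exact hR.trans he

lemma maxCodegree_antitone : Antitone H.maxCodegree :=
  antitone_nat_of_succ_le H.maxCodegree_succ_le

lemma degree_le_maxCodegree_one (v : Fin n) : H.degree v ≤ H.maxCodegree 1 := by
  have := H.codegree_le_maxCodegree {v}
  simpa [codegree, degree] using this

lemma sum_degree {q : ℕ} (hu : H.IsUniform q) : ∑ v, H.degree v = q * Fintype.card E := by
  simp only [degree, Finset.card_filter]
  rw [Finset.sum_comm]
  simp [hu _, mul_comm]

end Codegree

lemma IsProperColoring.eq_of_mem {H : MultiHypergraph n E} {color : E → κ}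
    (hc : H.IsProperColoring color) {e f : E} {v : Fin n}
    (he : v ∈ H.verts e) (hf : v ∈ H.verts f) (h : color e = color f) : e = f := by
  by_contra hne
  exact hc v e f he hf hne h

namespace StarPartition

variable {H : MultiHypergraph n E} {t : ℕ} {ι : Type*} [Fintype ι] {𝒮 : H.StarPartition t ι}
  {z : ι → Fin n} {J : Finset ι}

lemma enum_mem (e : E) (i : ι) : 𝒮.enum e i ∈ H.verts e \ 𝒮.center (𝒮.part e) := by
  rw [← 𝒮.image_enum]
  exact Finset.mem_image_of_mem _ (Finset.mem_univ _)

lemma card_image_of_forall_enum_eq {e : E} (h : ∀ i ∈ J, 𝒮.enum e i = z i) :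
    (J.image z).card = J.card :=
  Finset.card_image_of_injOn fun i hi j hj hij =>
    𝒮.enum_injective e ((h i hi).trans (hij.trans (h j hj).symm))

lemma image_subset_of_forall_enum_eq {e : E} (h : ∀ i ∈ J, 𝒮.enum e i = z i) :
    J.image z ⊆ H.verts e \ 𝒮.center (𝒮.part e) := by
  intro v hv
  obtain ⟨i, hi, rfl⟩ := Finset.mem_image.1 hv
  rw [← h i hi]
  exact enum_mem e i

end StarPartition

/-! ### Pairs in a common star with one color prescribed. -/

section Counting

variable [Fintype E] [DecidableEq κ] {H : MultiHypergraph n E} {color : E → κ}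

/-- A color class is a matching, so vertices chosen from its hyperedges are distinct. -/
lemma IsProperColoring.card_color_le (hc : H.IsProperColoring color)
    (hne : ∀ e, (H.verts e).Nonempty) (c : κ) :
    (Finset.univ.filter fun e => color e = c).card ≤ n := by
  choose v hv using hne
  have : ((Finset.univ.filter fun e => color e = c) : Set E).InjOn v := by
    intro e he f hf hef
    simp only [Finset.coe_filter, Finset.mem_univ, true_and, Set.mem_ofPred_eq] at he hf
    exact hc.eq_of_mem (hv e) (hef ▸ hv f) (he.trans hf.symm)
  simpa using Finset.card_le_card_of_injOn v (fun _ _ => Finset.mem_univ _) this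

variable {t : ℕ} {ι : Type*} [Fintype ι] [DecidableEq ι] (𝒮 : H.StarPartition t ι)

namespace StarPartition

/-- The pairs of hyperedges of the same star, the first one of color `c`, with prescribed
vertices. -/
def colorPairs (color : E → κ) (c : κ) (z : ι → Fin n) (I J : Finset ι) : Finset (E × E) :=
  Finset.univ.filter fun P => 𝒮.part P.1 = 𝒮.part P.2 ∧ color P.1 = c ∧
    (∀ i ∈ I, 𝒮.enum P.1 i = z i) ∧ ∀ i ∈ J, 𝒮.enum P.2 i = z i

variable {𝒮} {c : κ} {z : ι → Fin n} {I J : Finset ι}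

lemma card_colorPairs_le_mul [DecidableEq E] (hc : H.IsProperColoring color)
    (hne : ∀ e, (H.verts e).Nonempty) :
    (𝒮.colorPairs color c z I J).card ≤ n * H.maxCodegree t := by
  have hsub : 𝒮.colorPairs color c z I J ⊆
      (Finset.univ.filter fun e => color e = c).biUnion fun e =>
        {e} ×ˢ Finset.univ.filter fun f => 𝒮.center (𝒮.part e) ⊆ H.verts f := by
    rintro ⟨e, f⟩ h
    simp only [colorPairs, Finset.mem_filter, Finset.mem_univ, true_and] at h
    simp only [Finset.mem_biUnion, Finset.mem_filter, Finset.mem_univ, true_and,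
      Finset.mem_product, Finset.mem_singleton]
    exact ⟨e, h.2.1, rfl, h.1 ▸ 𝒮.center_subset f⟩
  refine (Finset.card_le_card hsub).trans ((Finset.card_biUnion_le_card_mul _ _ (H.maxCodegree t)
    fun e _ => ?_).trans (Nat.mul_le_mul_right _ (hc.card_color_le hne c)))
  rw [Finset.card_product, Finset.card_singleton, one_mul]
  exact (H.codegree_le_maxCodegree _).trans_eq (by rw [𝒮.card_center])

/-- The color and one vertex determine the first hyperedge. The second then contains its center and,
disjoint from it, the vertices prescribed on `J`. -/
lemma card_colorPairs_le_of_nonempty (hc : H.IsProperColoring color) (hI : I.Nonempty) :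
    (𝒮.colorPairs color c z I J).card ≤ H.maxCodegree (t + J.card) := by
  rcases (𝒮.colorPairs color c z I J).eq_empty_or_nonempty with h0 | ⟨⟨X, Y⟩, hXY⟩
  · simp [h0]
  obtain ⟨i, hi⟩ := hI
  simp only [colorPairs, Finset.mem_filter, Finset.mem_univ, true_and] at hXY
  obtain ⟨hp, hX, hXI, hYJ⟩ := hXY
  have hsub : 𝒮.colorPairs color c z I J ⊆
      {X} ×ˢ Finset.univ.filter fun f => 𝒮.center (𝒮.part X) ∪ J.image z ⊆ H.verts f := by
    rintro ⟨e, f⟩ h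
    simp only [colorPairs, Finset.mem_filter, Finset.mem_univ, true_and] at h
    obtain ⟨hp', he, heI, hfJ⟩ := h
    have heX : e = X := by
      refine hc.eq_of_mem (v := z i) ?_ ?_ (he.trans hX.symm)
      · exact heI i hi ▸ (Finset.mem_sdiff.1 (enum_mem e i)).1
      · exact hXI i hi ▸ (Finset.mem_sdiff.1 (enum_mem X i)).1
    subst heX
    simp only [Finset.mem_filter, Finset.mem_univ, true_and, Finset.mem_product,
      Finset.mem_singleton]
    exact Finset.union_subset (hp' ▸ 𝒮.center_subset f)
      ((image_subset_of_forall_enum_eq hfJ).trans Finset.sdiff_subset)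
  refine (Finset.card_le_card hsub).trans ?_
  rw [Finset.card_product, Finset.card_singleton, one_mul]
  refine (H.codegree_le_maxCodegree _).trans_eq ?_
  rw [Finset.card_union_of_disjoint, 𝒮.card_center, card_image_of_forall_enum_eq hYJ]
  rw [hp]
  exact Finset.disjoint_of_subset_right (image_subset_of_forall_enum_eq hYJ) Finset.disjoint_sdiff

/-- The second hyperedge determines the first, by the color and a vertex of the nonempty common
center. -/
lemma card_colorPairs_le (hc : H.IsProperColoring color) (ht : 0 < t) :
    (𝒮.colorPairs color c z I J).card ≤ H.maxCodegree J.card := by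
  rcases (𝒮.colorPairs color c z I J).eq_empty_or_nonempty with h0 | ⟨⟨X, Y⟩, hXY⟩
  · simp [h0]
  simp only [colorPairs, Finset.mem_filter, Finset.mem_univ, true_and] at hXY
  rw [← card_image_of_forall_enum_eq hXY.2.2.2]
  refine le_trans ?_ (H.codegree_le_maxCodegree _)
  refine Finset.card_le_card_of_injOn Prod.snd ?_ ?_
  · rintro ⟨e, f⟩ h
    simp only [colorPairs, Finset.coe_filter, Finset.mem_univ, true_and, Set.mem_ofPred_eq] at h ⊢
    exact (image_subset_of_forall_enum_eq h.2.2.2).trans Finset.sdiff_subset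
  · rintro ⟨e, f⟩ h ⟨e', f'⟩ h' hff
    simp only [colorPairs, Finset.coe_filter, Finset.mem_univ, true_and, Set.mem_ofPred_eq] at h h'
    obtain rfl : f = f' := hff
    obtain ⟨v, hv⟩ := Finset.card_pos.1 ((𝒮.card_center (𝒮.part f)).symm ▸ ht)
    have : e = e' := hc.eq_of_mem (𝒮.center_subset e (h.1 ▸ hv))
      (𝒮.center_subset e' (h'.1 ▸ hv)) (h.2.1.trans h'.2.1.symm)
    rw [this]

end StarPartition

end Counting

/-! ### Linear algebra over the two-element field. -/

section Span

/-- The incidence vector of a hyperedge over the field with two elements. -/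
def incidence (H : MultiHypergraph n E) (e : E) : Fin n → ZMod 2 :=
  fun v => if v ∈ H.verts e then 1 else 0

/-- The span of the incidence vectors of the hyperedges of color different from `c`. -/
def otherSpan (H : MultiHypergraph n E) (color : E → κ) (c : κ) :
    Submodule (ZMod 2) (Fin n → ZMod 2) :=
  Submodule.span (ZMod 2) (H.incidence '' {e | color e ≠ c})

lemma incidence_mem_otherSpan {H : MultiHypergraph n E} {color : E → κ} {e : E} {c : κ}
    (h : color e ≠ c) : H.incidence e ∈ H.otherSpan color c :=
  Submodule.subset_span ⟨e, h, rfl⟩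

/-- A hyperedge that is spanned by the hyperedges of other colors yields a weakly rainbow even
cover. -/
lemma exists_weaklyRainbow_of_mem_otherSpan [Fintype E] {H : MultiHypergraph n E} {color : E → κ}
    {e : E} (h : H.incidence e ∈ H.otherSpan color (color e)) :
    ∃ S : Finset E, H.IsWeaklyRainbowEvenCover color S := by
  classical
  rw [otherSpan, Fintype.mem_span_image_iff_exists_fun] at h
  obtain ⟨w, hw⟩ := h
  -- The value 0 on the color of `e` later makes `e` the only hyperedge of its color in the cover.
  let w' : E → ZMod 2 := fun f => if hf : color f ≠ color e then w ⟨f, hf⟩ else 0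
  have hw' : ∑ f, w' f • H.incidence f = H.incidence e := by
    rw [← hw]
    rw [← Finset.sum_subset (Finset.subset_univ (Finset.univ.filter fun f => color f ≠ color e))]
    · rw [Finset.sum_subtype (p := fun f => f ∈ {f | color f ≠ color e}) _ (by simp)]
      refine Finset.sum_congr rfl fun f _ => ?_
      have : color f ≠ color e := f.2
      simp [w', this]
    · intro f _ hf
      simp only [Finset.mem_filter, Finset.mem_univ, true_and, not_not] at hf
      simp [w', hf]
  set F : Finset E := Finset.univ.filter fun f => w' f = 1
  have heF : e ∉ F := by simp [F, w']
  refine ⟨insert e F, fun v => ?_, color e, e, ⟨by simp, rfl⟩, ?_⟩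
  · rw [← ZMod.natCast_eq_zero_iff_even, Finset.card_filter, Nat.cast_sum,
      Finset.sum_insert heF]
    have hv := congrFun hw' v
    have hF : ∑ f ∈ F, H.incidence f v = H.incidence e v := by
      rw [← hv, Finset.sum_apply]
      simp only [Pi.smul_apply, smul_eq_mul, F]
      rw [Finset.sum_filter]
      refine Finset.sum_congr rfl fun f _ => ?_
      have : ∀ a : ZMod 2, a = 0 ∨ a = 1 := by decide
      rcases this (w' f) with h | h <;> simp [h]
    have hcast : ∀ f, ((if v ∈ H.verts f then 1 else 0 : ℕ) : ZMod 2) = H.incidence f v := by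
      intro f; simp [incidence]
    simp_rw [hcast, hF]
    exact CharTwo.add_self_eq_zero _
  · rintro f ⟨hf, hfe⟩
    rcases Finset.mem_insert.1 hf with rfl | hf
    · rfl
    · simp [F, w', hfe] at hf

end Span

end MultiHypergraph

namespace MultiHypergraph

variable {n : ℕ} {E κ : Type*} [Fintype E] [DecidableEq E] [DecidableEq κ]
  {H : MultiHypergraph n E} {color : E → κ} {t a b L : ℕ}

namespace StarPartition

/-! ### Mixed halves of two hyperedges. -/

section Mix

variable (𝒮 : H.StarPartition t (Fin a ⊕ Fin b))

/-- Half of the vertices of `X` together with half of the vertices of `Y`. -/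
def mix (X Y : E) : Fin a ⊕ Fin b → Fin n :=
  Sum.elim (fun i => 𝒮.enum X (Sum.inl i)) (fun j => 𝒮.enum Y (Sum.inr j))

/-- The pairs of hyperedges of the same star that involve the color `c` and whose mix is prescribed
on `I`. -/
def mixPairs (color : E → κ) (c : κ) (z : Fin a ⊕ Fin b → Fin n) (I : Finset (Fin a ⊕ Fin b)) :
    Finset (E × E) :=
  Finset.univ.filter fun P => 𝒮.part P.1 = 𝒮.part P.2 ∧ (color P.1 = c ∨ color P.2 = c) ∧
    ∀ i ∈ I, 𝒮.mix P.1 P.2 i = z i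

variable {𝒮} {c : κ} {z : Fin a ⊕ Fin b → Fin n} {I : Finset (Fin a ⊕ Fin b)}

/-- The colored hyperedge may supply either half of the mix; in the second case the pair is swapped.
-/
lemma card_mixPairs_le :
    (𝒮.mixPairs color c z I).card ≤
      (𝒮.colorPairs color c z (I.filter fun i => i.isLeft) (I.filter fun i => ¬ i.isLeft)).card +
      (𝒮.colorPairs color c z (I.filter fun i => ¬ i.isLeft) (I.filter fun i => i.isLeft)).card := by
  have : 𝒮.mixPairs color c z I ⊆
      (𝒮.colorPairs color c z (I.filter fun i => i.isLeft) (I.filter fun i => ¬ i.isLeft)) ∪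
      (𝒮.colorPairs color c z (I.filter fun i => ¬ i.isLeft)
        (I.filter fun i => i.isLeft)).image Prod.swap := by
    rintro ⟨X, Y⟩ h
    simp only [mixPairs, Finset.mem_filter, Finset.mem_univ, true_and] at h
    obtain ⟨hp, hc, hI⟩ := h
    have hl : ∀ i ∈ I.filter fun i => i.isLeft, 𝒮.enum X i = z i := by
      rintro (i | i) hi
      · exact hI _ (Finset.mem_filter.1 hi).1
      · simp at hi
    have hr : ∀ i ∈ I.filter fun i => ¬ i.isLeft, 𝒮.enum Y i = z i := by
      rintro (i | i) hi
      · simp at hi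
      · exact hI _ (Finset.mem_filter.1 hi).1
    rw [Finset.mem_union, Finset.mem_image]
    rcases hc with hc | hc
    · left
      simp only [colorPairs, Finset.mem_filter, Finset.mem_univ, true_and]
      exact ⟨hp, hc, by simpa using hl, by simpa using hr⟩
    · right
      refine ⟨(Y, X), ?_, rfl⟩
      simp only [colorPairs, Finset.mem_filter, Finset.mem_univ, true_and]
      exact ⟨hp.symm, hc, by simpa using hr, by simpa using hl⟩
  exact (Finset.card_le_card this).trans ((Finset.card_union_le _ _).trans
    (Nat.add_le_add_left Finset.card_image_le _))

/-- Each prescribed vertex should cost a factor `l`. The cases are: nothing prescribed, only `J`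
nonempty (`h1`), and `I` nonempty (`h2`), where the exponent `a + j` already covers all of `I`. -/
lemma card_colorPairs_le_mul_pow (hc : H.IsProperColoring color)
    (hne : ∀ e, (H.verts e).Nonempty) (ht : 0 < t) (hba : b ≤ a) (hab : a ≤ b + 1)
    {l : ℝ} (hl0 : 0 ≤ l) (hl1 : l ≤ 1)
    (h1 : ∀ j, 1 ≤ j → j ≤ a → (H.maxCodegree j : ℝ) ≤ n * H.maxCodegree t * l ^ j)
    (h2 : ∀ j, j ≤ b → (H.maxCodegree (t + j) : ℝ) ≤ n * H.maxCodegree t * l ^ (a + j))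
    {I J : Finset (Fin a ⊕ Fin b)}
    (hIJ : (I.card ≤ a ∧ J.card ≤ b) ∨ (I.card ≤ b ∧ J.card ≤ a)) :
    ((𝒮.colorPairs color c z I J).card : ℝ) ≤ n * H.maxCodegree t * l ^ (I.card + J.card) := by
  rcases I.eq_empty_or_nonempty with rfl | hI
  · rcases J.eq_empty_or_nonempty with rfl | hJ
    · simpa using (by exact_mod_cast card_colorPairs_le_mul hc hne :
        ((𝒮.colorPairs color c z ∅ ∅).card : ℝ) ≤ n * H.maxCodegree t)
    · rw [Finset.card_empty, zero_add]
      have hJ' := hJ.card_pos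
      refine le_trans ?_ (h1 J.card hJ' (by omega))
      exact_mod_cast card_colorPairs_le hc ht
  · refine le_trans (Nat.cast_le.2 (card_colorPairs_le_of_nonempty hc hI)) ?_
    by_cases hb : J.card ≤ b
    · refine (h2 _ hb).trans ?_
      exact mul_le_mul_of_nonneg_left (pow_le_pow_of_le_one hl0 hl1 (by omega)) (by positivity)
    -- Here `J.card = b + 1 = a` and `I.card ≤ b`; only `b` vertices of `J` are used, and `l ^ (a +
    -- b)` still suffices.
    · refine le_trans (Nat.cast_le.2 (H.maxCodegree_antitone (show t + b ≤ t + J.card by omega)))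
        ((h2 _ le_rfl).trans ?_)
      exact mul_le_mul_of_nonneg_left (pow_le_pow_of_le_one hl0 hl1 (by omega)) (by positivity)

lemma card_mixPairs_le_mul_pow (hc : H.IsProperColoring color)
    (hne : ∀ e, (H.verts e).Nonempty) (ht : 0 < t) (hba : b ≤ a) (hab : a ≤ b + 1)
    {l : ℝ} (hl0 : 0 ≤ l) (hl1 : l ≤ 1)
    (h1 : ∀ j, 1 ≤ j → j ≤ a → (H.maxCodegree j : ℝ) ≤ n * H.maxCodegree t * l ^ j)
    (h2 : ∀ j, j ≤ b → (H.maxCodegree (t + j) : ℝ) ≤ n * H.maxCodegree t * l ^ (a + j)) :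
    ((𝒮.mixPairs color c z I).card : ℝ) ≤ 2 * (n * H.maxCodegree t) * l ^ I.card := by
  have hl : (I.filter fun i => i.isLeft).card ≤ a := by
    refine (Finset.card_le_card (t := Finset.univ.image Sum.inl) ?_).trans
      (Finset.card_image_le.trans (by simp))
    rintro (i | i) hi
    · simp
    · simp at hi
  have hr : (I.filter fun i => ¬ i.isLeft).card ≤ b := by
    refine (Finset.card_le_card (t := Finset.univ.image Sum.inr) ?_).trans
      (Finset.card_image_le.trans (by simp))
    rintro (i | i) hi
    · simp at hi
    · simp
  have hcard := Finset.card_filter_add_card_filter_not (s := I) (fun i => i.isLeft = true)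
  have e1 := card_colorPairs_le_mul_pow (𝒮 := 𝒮) (c := c) (z := z) hc hne ht hba hab hl0 hl1 h1 h2
    (Or.inl ⟨hl, hr⟩)
  have e2 := card_colorPairs_le_mul_pow (𝒮 := 𝒮) (c := c) (z := z) hc hne ht hba hab hl0 hl1 h1 h2
    (Or.inr ⟨hr, hl⟩)
  rw [hcard] at e1
  rw [add_comm, hcard] at e2
  have : ((𝒮.mixPairs color c z I).card : ℝ) ≤ _ := Nat.cast_le.2 card_mixPairs_le
  push_cast at this
  linarith

end Mix

/-! ### The Kikuchi-type graph and its color degrees. -/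

section Graph

variable (𝒮 : H.StarPartition t (Fin a ⊕ Fin b))

/-- The label `((X, Y), p)` leads from the point `x` to the point obtained by replacing the mix of
`X` and `Y` at the positions `p` by the mix of `Y` and `X`. -/
def Matches (l : (E × E) × (Fin a ⊕ Fin b → Fin L)) (x : Fin a ⊕ Fin b → Fin L → Fin n) : Prop :=
  𝒮.part l.1.1 = 𝒮.part l.1.2 ∧ l.1.1 ≠ l.1.2 ∧ ∀ i, x i (l.2 i) = 𝒮.mix l.1.1 l.1.2 i

instance (l : (E × E) × (Fin a ⊕ Fin b → Fin L)) (x : Fin a ⊕ Fin b → Fin L → Fin n) :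
    Decidable (𝒮.Matches l x) := by
  unfold Matches; infer_instance

/-- The end point of the label `l` at `x`. -/
def move (l : (E × E) × (Fin a ⊕ Fin b → Fin L)) (x : Fin a ⊕ Fin b → Fin L → Fin n) :
    Fin a ⊕ Fin b → Fin L → Fin n :=
  fun i => Function.update (x i) (l.2 i) (𝒮.mix l.1.2 l.1.1 i)

/-- The reversed label. -/
def rev (l : (E × E) × (Fin a ⊕ Fin b → Fin L)) : (E × E) × (Fin a ⊕ Fin b → Fin L) :=
  (l.1.swap, l.2)

@[simp] lemma rev_rev (l : (E × E) × (Fin a ⊕ Fin b → Fin L)) : rev (rev l) = l := rfl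

/-- The number of labels at `x` that involve the color `c`. -/
def colorDegree (color : E → κ) (c : κ) (x : Fin a ⊕ Fin b → Fin L → Fin n) : ℕ :=
  (Finset.univ.filter fun l : (E × E) × (Fin a ⊕ Fin b → Fin L) =>
    𝒮.Matches l x ∧ (color l.1.1 = c ∨ color l.1.2 = c)).card

variable {𝒮} {l : (E × E) × (Fin a ⊕ Fin b → Fin L)} {x : Fin a ⊕ Fin b → Fin L → Fin n}

lemma Matches.rev_move (h : 𝒮.Matches l x) : 𝒮.Matches (rev l) (𝒮.move l x) :=
  ⟨h.1.symm, h.2.1.symm, fun i => by simp [rev, move]⟩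

lemma Matches.move_rev_move (h : 𝒮.Matches l x) : 𝒮.move (rev l) (𝒮.move l x) = x := by
  funext i
  simp only [move, rev, Prod.snd_swap, Prod.fst_swap, Function.update_idem]
  rw [← h.2.2 i, Function.update_eq_self]

/-- Labels sharing the positions in `I` with `p` gain a factor `(L / n) ^ (-I.card)` in probability,
and `hB` makes the pairs that agree with `z` on `I` rarer by exactly that factor. Each of the `2 ^
(a + b)` sets `I` thus contributes equally to the bound. -/
lemma sum_colorDegree_le (hn : 0 < n) {c : κ} {B : ℝ}
    (hB : ∀ z I, ((𝒮.mixPairs color c z I).card : ℝ) ≤ B * ((L : ℝ) / n) ^ I.card)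
    (p : Fin a ⊕ Fin b → Fin L) (z : Fin a ⊕ Fin b → Fin n) :
    ∑ x ∈ Finset.univ.filter fun x : Fin a ⊕ Fin b → Fin L → Fin n => ∀ i, x i (p i) = z i,
      (𝒮.colorDegree color c x : ℝ) ≤
      ((n : ℝ) ^ (L - 1)) ^ (a + b) * (2 ^ (a + b) * B * ((L : ℝ) / n) ^ (a + b)) := by
  have hlhs : ∑ x ∈ Finset.univ.filter fun x : Fin a ⊕ Fin b → Fin L → Fin n =>
      ∀ i, x i (p i) = z i, (𝒮.colorDegree color c x : ℝ) ≤
      ∑ P ∈ 𝒮.mixPairs color c z ∅, ∑ p' : Fin a ⊕ Fin b → Fin L,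
        ((Finset.univ.filter fun x : Fin a ⊕ Fin b → Fin L → Fin n =>
          (∀ i, x i (p i) = z i) ∧ ∀ i, x i (p' i) = 𝒮.mix P.1 P.2 i).card : ℝ) := by
    rw [← Finset.sum_product']
    simp only [colorDegree, ← Nat.cast_sum, Nat.cast_le]
    rw [← Finset.card_sigma, ← Finset.card_sigma]
    refine Finset.card_le_card_of_injOn (fun s => ⟨s.2, s.1⟩) ?_ ?_
    · rintro ⟨x, l⟩ h
      rw [Finset.mem_coe, Finset.mem_sigma] at h ⊢
      obtain ⟨hx, hl⟩ := h
      obtain ⟨⟨hp, -, hm⟩, hcol⟩ := (Finset.mem_filter.1 hl).2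
      simp only [Finset.mem_filter, Finset.mem_univ, true_and, Finset.mem_product, and_true,
        mixPairs] at hx ⊢
      exact ⟨⟨hp, hcol, by simp⟩, hx, hm⟩
    · rintro ⟨x, l⟩ - ⟨x', l'⟩ - h
      simp only [Sigma.mk.injEq, heq_eq_eq] at h
      obtain ⟨rfl, rfl⟩ := h
      rfl
  refine hlhs.trans ?_
  calc _ ≤ ∑ P ∈ 𝒮.mixPairs color c z ∅, ((n : ℝ) ^ (L - 1)) ^ (a + b) *
        ∑ I : Finset (Fin a ⊕ Fin b), if ∀ i ∈ I, 𝒮.mix P.1 P.2 i = z i then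
          ((L : ℝ) / n) ^ (a + b - I.card) else 0 := by
        refine Finset.sum_le_sum fun P _ => ?_
        simpa using sum_card_filter_forall_and_le hn p z (𝒮.mix P.1 P.2)
    _ = ((n : ℝ) ^ (L - 1)) ^ (a + b) * ∑ I : Finset (Fin a ⊕ Fin b),
          ((𝒮.mixPairs color c z I).card : ℝ) * ((L : ℝ) / n) ^ (a + b - I.card) := by
        rw [← Finset.mul_sum, Finset.sum_comm]
        congr 1
        refine Finset.sum_congr rfl fun I _ => ?_
        rw [← Finset.sum_filter, Finset.sum_const, nsmul_eq_mul]
        congr 2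
        congr 1
        ext P
        simp [mixPairs, and_assoc]
    _ ≤ ((n : ℝ) ^ (L - 1)) ^ (a + b) * ∑ I : Finset (Fin a ⊕ Fin b),
          B * ((L : ℝ) / n) ^ (a + b) := by
        refine mul_le_mul_of_nonneg_left (Finset.sum_le_sum fun I _ => ?_) (by positivity)
        have hI : I.card ≤ a + b := by simpa using I.card_le_univ
        calc _ ≤ B * ((L : ℝ) / n) ^ I.card * ((L : ℝ) / n) ^ (a + b - I.card) := by
              exact mul_le_mul_of_nonneg_right (hB z I) (by positivity)
          _ = _ := by rw [mul_assoc, ← pow_add, Nat.add_sub_cancel' hI]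
    _ = _ := by
        rw [Finset.sum_const, Finset.card_univ, Fintype.card_finset, nsmul_eq_mul]
        simp [mul_assoc]

end Graph

end StarPartition

end MultiHypergraph

namespace MultiHypergraph

variable {n : ℕ} {E κ : Type*} {H : MultiHypergraph n E} {color : E → κ} {t a b L : ℕ}

/-! ### The potential and its change along an edge. -/

section Potential

/-- The sum over the two-element field of the unit vectors at all letters of `x`. -/
def potential {ι : Type*} [Fintype ι] (x : ι → Fin L → Fin n) : Fin n → ZMod 2 :=
  ∑ i, ∑ k, Pi.single (x i k) 1

lemma incidence_eq_sum_single (e : E) :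
    H.incidence e = ∑ v ∈ H.verts e, Pi.single v (1 : ZMod 2) := by
  funext u
  simp [incidence, Finset.sum_apply, Pi.single_apply]

lemma StarPartition.sum_single_enum {ι : Type*} [Fintype ι] (𝒮 : H.StarPartition t ι) (e : E) :
    ∑ i, Pi.single (𝒮.enum e i) (1 : ZMod 2) + ∑ v ∈ 𝒮.center (𝒮.part e), Pi.single v 1 =
      H.incidence e := by
  rw [incidence_eq_sum_single, ← Finset.sum_sdiff (𝒮.center_subset e), ← 𝒮.image_enum,
    Finset.sum_image fun i _ j _ h => 𝒮.enum_injective e h]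

/-- Unchanged letters cancel modulo 2. The old and new letters together enumerate both hyperedges
outside the common center, which also cancels. -/
lemma StarPartition.Matches.potential_move_add [DecidableEq E]
    {𝒮 : H.StarPartition t (Fin a ⊕ Fin b)}
    {l : (E × E) × (Fin a ⊕ Fin b → Fin L)} {x : Fin a ⊕ Fin b → Fin L → Fin n}
    (h : 𝒮.Matches l x) :
    potential (𝒮.move l x) + potential x = H.incidence l.1.1 + H.incidence l.1.2 := by
  have h2 : ∀ u : Fin n → ZMod 2, u + u = 0 := fun u => by
    funext v; exact CharTwo.add_self_eq_zero _
  have hi : ∀ i, (∑ k, Pi.single (𝒮.move l x i k) 1 + ∑ k, Pi.single (x i k) 1 :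
      Fin n → ZMod 2) = Pi.single (𝒮.enum l.1.1 i) 1 + Pi.single (𝒮.enum l.1.2 i) 1 := by
    intro i
    rw [← Finset.add_sum_erase _ _ (Finset.mem_univ (l.2 i)),
      ← Finset.add_sum_erase _ (fun k => (Pi.single (x i k) 1 : Fin n → ZMod 2))
        (Finset.mem_univ (l.2 i))]
    have : (∑ k ∈ Finset.univ.erase (l.2 i), Pi.single (𝒮.move l x i k) 1 : Fin n → ZMod 2) =
        ∑ k ∈ Finset.univ.erase (l.2 i), Pi.single (x i k) 1 := by
      refine Finset.sum_congr rfl fun k hk => ?_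
      rw [move, Function.update_of_ne (Finset.ne_of_mem_erase hk)]
    rw [this, add_add_add_comm, h2, add_zero, h.2.2 i, move, Function.update_self]
    rcases i with i | i
    · simp [mix, add_comm]
    · simp [mix]
  rw [potential, potential, ← Finset.sum_add_distrib, Finset.sum_congr rfl fun i _ => hi i,
    Finset.sum_add_distrib, ← 𝒮.sum_single_enum l.1.1, ← 𝒮.sum_single_enum l.1.2, ← h.1,
    add_add_add_comm, h2, add_zero]

end Potential

/-! ### Good edges and the upper bound on pairs. -/

namespace StarPartition

variable [Fintype E] [DecidableEq E] [DecidableEq κ] (𝒮 : H.StarPartition t (Fin a ⊕ Fin b))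

/-- The label matches `x`, and its colors have degree at most `D` at both of its end points. -/
def Good (color : E → κ) (D : ℝ) (l : (E × E) × (Fin a ⊕ Fin b → Fin L))
    (x : Fin a ⊕ Fin b → Fin L → Fin n) : Prop :=
  𝒮.Matches l x ∧ ∀ c, color l.1.1 = c ∨ color l.1.2 = c →
    (𝒮.colorDegree color c x : ℝ) ≤ D ∧ (𝒮.colorDegree color c (𝒮.move l x) : ℝ) ≤ D

variable {𝒮}

lemma Good.rev_move {D : ℝ} {l : (E × E) × (Fin a ⊕ Fin b → Fin L)}
    {x : Fin a ⊕ Fin b → Fin L → Fin n} (h : 𝒮.Good color D l x) :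
    𝒮.Good color D (rev l) (𝒮.move l x) := by
  refine ⟨h.1.rev_move, fun c hc => ?_⟩
  rw [h.1.move_rev_move]
  exact (h.2 c hc.symm).symm

open Classical in
/-- The isoperimetric bound for the graph of good labels. -/
lemma card_good_le (hc : H.IsProperColoring color) (ht : 0 < t)
    (hno : ∀ e, H.incidence e ∉ H.otherSpan color (color e)) {D : ℝ} (hD : 0 ≤ D) :
    ((Finset.univ.filter fun s : (Fin a ⊕ Fin b → Fin L → Fin n) ×
        ((E × E) × (Fin a ⊕ Fin b → Fin L)) => 𝒮.Good color D s.2 s.1).card : ℝ) ≤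
      2 * D * (Fintype.card (Fin a ⊕ Fin b → Fin L → Fin n) *
        Real.logb 2 (Fintype.card (Fin a ⊕ Fin b → Fin L → Fin n))) := by
  let w : (Fin a ⊕ Fin b → Fin L → Fin n) → (Fin a ⊕ Fin b → Fin L → Fin n) → ℝ := fun x y =>
    ((Finset.univ.filter fun l => 𝒮.Good color D l x ∧ 𝒮.move l x = y).card : ℝ)
  have hfib : ∀ x, ∀ T : Finset (Fin a ⊕ Fin b → Fin L → Fin n), ∑ y ∈ T, w x y =
      ((Finset.univ.filter fun l => 𝒮.Good color D l x ∧ 𝒮.move l x ∈ T).card : ℝ) := by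
    intro x T
    rw [Finset.card_eq_sum_card_fiberwise (f := fun l => 𝒮.move l x) (t := T)
      (fun l hl => by simpa using (Finset.mem_filter.1 hl).2.2)]
    push_cast
    refine Finset.sum_congr rfl fun y hy => ?_
    simp only [w]
    congr 2
    ext l
    simp only [Finset.mem_filter, Finset.mem_univ, true_and]
    constructor
    · rintro ⟨h1, rfl⟩
      exact ⟨⟨h1, hy⟩, rfl⟩
    · rintro ⟨⟨h1, -⟩, h2⟩
      exact ⟨h1, h2⟩
  have hle : ∀ x y, w x y ≤ w y x := by
    intro x y
    refine Nat.cast_le.2 (Finset.card_le_card_of_injOn rev ?_ ?_)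
    · intro l hl
      obtain ⟨h1, rfl⟩ := (Finset.mem_filter.1 hl).2
      exact Finset.mem_coe.2 (Finset.mem_filter.2
        ⟨Finset.mem_univ _, h1.rev_move, h1.1.move_rev_move⟩)
    · intro l _ l' _ h
      rw [← rev_rev l, h, rev_rev]
  have hmain := sum_weight_le_of_cuts w (fun x y => le_antisymm (hle x y) (hle y x)) hD ?_
    Finset.univ
  · rw [Finset.card_univ] at hmain
    refine le_trans (le_of_eq ?_) hmain
    simp only [hfib, Finset.mem_univ, and_true]
    rw [← Nat.cast_sum, ← Finset.card_sigma]
    congr 1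
    refine Finset.card_bij' (fun s _ => ⟨s.1, s.2⟩) (fun s _ => (s.1, s.2)) ?_ ?_ ?_ ?_ <;> simp
  · intro x y hxy
    have hpos : (Finset.univ.filter fun l => 𝒮.Good color D l x ∧ 𝒮.move l x = y).card ≠ 0 :=
      fun h => hxy (by simp only [w, h, Nat.cast_zero])
    obtain ⟨l, hl⟩ := Finset.card_pos.1 (Nat.pos_of_ne_zero hpos)
    obtain ⟨hgood, rfl⟩ := (Finset.mem_filter.1 hl).2
    have h2 : ∀ u : Fin n → ZMod 2, u + u = 0 := fun u => by
      funext v; exact CharTwo.add_self_eq_zero _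
    -- The cut is a coset condition modulo the span of the colors other than `color l.1.1`. The edge
    -- `l` leaves it because exactly one of its two incidence vectors lies in that span.
    refine ⟨fun z => potential z + potential x ∈ H.otherSpan color (color l.1.1), ?_, ?_, ?_⟩
    · simp only [h2, Submodule.zero_mem]
    · simp only [hgood.1.potential_move_add]
      intro hmem
      refine hno l.1.1 ?_
      -- Distinct hyperedges of one star share a center vertex, so a proper coloring separates them.
      have hne : color l.1.2 ≠ color l.1.1 := by
        intro h
        obtain ⟨v, hv⟩ := Finset.card_pos.1 ((𝒮.card_center (𝒮.part l.1.1)).symm ▸ ht)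
        exact hgood.1.2.1 (hc.eq_of_mem (𝒮.center_subset _ hv)
          (𝒮.center_subset _ (hgood.1.1 ▸ hv)) h.symm)
      exact (Submodule.add_mem_iff_left _ (incidence_mem_otherSpan hne)).1 hmem
    · intro v T hT
      rw [hfib]
      -- The color degree at `v` is not bounded a priori: a single good crossing edge certifies that
      -- it is at most `D`, and without one there is nothing to bound.
      rcases (Finset.univ.filter fun l => 𝒮.Good color D l v ∧
        𝒮.move l v ∈ T).eq_empty_or_nonempty with h0 | ⟨l', hl'⟩
      · rw [h0]; simpa using hD
      have hinv : ∀ l', 𝒮.Good color D l' v → 𝒮.move l' v ∈ T →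
          color l'.1.1 = color l.1.1 ∨ color l'.1.2 = color l.1.1 := by
        intro l' hg hm
        by_contra! hcon
        refine hT _ hm ?_
        have hmem := Submodule.add_mem _ (incidence_mem_otherSpan (H := H) hcon.1)
          (incidence_mem_otherSpan (H := H) hcon.2)
        rw [← hg.1.potential_move_add] at hmem
        have hrw : potential (𝒮.move l' v) + potential x =
            (potential (𝒮.move l' v) + potential v) + (potential v + potential x) := by
          rw [add_assoc, ← add_assoc (potential v), h2, zero_add]
        simp only [hrw]
        exact Submodule.add_mem_iff_right _ hmem
      obtain ⟨hg', hm'⟩ := (Finset.mem_filter.1 hl').2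
      refine le_trans (Nat.cast_le.2 (Finset.card_le_card ?_))
        (hg'.2 (color l.1.1) (hinv l' hg' hm')).1
      intro l'' hl''
      obtain ⟨hg, hm⟩ := (Finset.mem_filter.1 hl'').2
      exact Finset.mem_filter.2 ⟨Finset.mem_univ _, hg.1, hinv l'' hg hm⟩

variable (𝒮)

/-- The ordered pairs of distinct hyperedges of the same star. -/
def starPairs : Finset (E × E) :=
  Finset.univ.filter fun P => 𝒮.part P.1 = 𝒮.part P.2 ∧ P.1 ≠ P.2

/-- The pairs of a point and a label that matches it. -/
def incidences (L : ℕ) : Finset ((Fin a ⊕ Fin b → Fin L → Fin n) ×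
    ((E × E) × (Fin a ⊕ Fin b → Fin L))) :=
  Finset.univ.filter fun s => 𝒮.Matches s.2 s.1

variable {𝒮}

lemma sum_incidences (f : (Fin a ⊕ Fin b → Fin L → Fin n) →
    ((E × E) × (Fin a ⊕ Fin b → Fin L)) → ℝ) :
    ∑ s ∈ 𝒮.incidences L, f s.1 s.2 =
      ∑ l ∈ 𝒮.starPairs ×ˢ (Finset.univ : Finset (Fin a ⊕ Fin b → Fin L)),
      ∑ x ∈ Finset.univ.filter fun x : Fin a ⊕ Fin b → Fin L → Fin n =>
        ∀ i, x i (l.2 i) = 𝒮.mix l.1.1 l.1.2 i, f x l := by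
  rw [Finset.sum_sigma']
  refine Finset.sum_bij' (fun s _ => ⟨s.2, s.1⟩) (fun s _ => (s.2, s.1)) ?_ ?_ ?_ ?_ ?_
  · rintro ⟨x, l⟩ h
    obtain ⟨h1, h2, h3⟩ := (Finset.mem_filter.1 h).2
    exact Finset.mem_sigma.2 ⟨Finset.mem_product.2 ⟨Finset.mem_filter.2
      ⟨Finset.mem_univ _, h1, h2⟩, Finset.mem_univ _⟩, Finset.mem_filter.2 ⟨Finset.mem_univ _, h3⟩⟩
  · rintro ⟨l, x⟩ h
    rw [Finset.mem_sigma, Finset.mem_product] at h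
    obtain ⟨⟨h1, -⟩, h2⟩ := h
    have h1 := (Finset.mem_filter.1 h1).2
    exact Finset.mem_filter.2 ⟨Finset.mem_univ _, h1.1, h1.2, (Finset.mem_filter.1 h2).2⟩
  · simp
  · simp
  · simp

lemma card_incidences : ((𝒮.incidences L).card : ℝ) =
    ((𝒮.starPairs ×ˢ (Finset.univ : Finset (Fin a ⊕ Fin b → Fin L))).card : ℝ) *
      ((n : ℝ) ^ (L - 1)) ^ (a + b) := by
  have := sum_incidences (𝒮 := 𝒮) (L := L) (fun _ _ => 1)
  simp only [Finset.sum_const, nsmul_eq_mul, mul_one, card_filter_forall_apply_eq] at this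
  rw [this]
  simp

/-- Markov's inequality. The averaging hypothesis holds for each label separately, so the color may
depend on the label through `f`. -/
lemma card_filter_lt_colorDegree_le {Γ D : ℝ}
    (hΓ : ∀ c, ∀ (p : Fin a ⊕ Fin b → Fin L) (z : Fin a ⊕ Fin b → Fin n),
      ∑ x ∈ Finset.univ.filter fun x : Fin a ⊕ Fin b → Fin L → Fin n => ∀ i, x i (p i) = z i,
        (𝒮.colorDegree color c x : ℝ) ≤ ((n : ℝ) ^ (L - 1)) ^ (a + b) * Γ)
    (f : ((E × E) × (Fin a ⊕ Fin b → Fin L)) → κ) :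
    (((𝒮.incidences L).filter fun s => D < 𝒮.colorDegree color (f s.2) s.1).card : ℝ) * D ≤
      (𝒮.incidences L).card * Γ := by
  calc _ ≤ ∑ s ∈ (𝒮.incidences L).filter fun s => D < 𝒮.colorDegree color (f s.2) s.1,
        (𝒮.colorDegree color (f s.2) s.1 : ℝ) := by
        rw [← nsmul_eq_mul]
        exact Finset.card_nsmul_le_sum _ _ _ fun s hs => (Finset.mem_filter.1 hs).2.le
    _ ≤ ∑ s ∈ 𝒮.incidences L, (𝒮.colorDegree color (f s.2) s.1 : ℝ) :=
        Finset.sum_le_sum_of_subset_of_nonneg (Finset.filter_subset _ _) fun _ _ _ => by positivity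
    _ ≤ ∑ l ∈ 𝒮.starPairs ×ˢ (Finset.univ : Finset (Fin a ⊕ Fin b → Fin L)),
          ((n : ℝ) ^ (L - 1)) ^ (a + b) * Γ := by
        rw [sum_incidences (fun x l => (𝒮.colorDegree color (f l) x : ℝ))]
        exact Finset.sum_le_sum fun l _ => hΓ _ _ _
    _ = _ := by
        rw [Finset.sum_const, nsmul_eq_mul, card_incidences]
        ring

lemma card_incidences_le (hc : H.IsProperColoring color) (ht : 0 < t)
    (hno : ∀ e, H.incidence e ∉ H.otherSpan color (color e)) {Γ : ℝ} (hΓ0 : 0 < Γ)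
    (hΓ : ∀ c, ∀ (p : Fin a ⊕ Fin b → Fin L) (z : Fin a ⊕ Fin b → Fin n),
      ∑ x ∈ Finset.univ.filter fun x : Fin a ⊕ Fin b → Fin L → Fin n => ∀ i, x i (p i) = z i,
        (𝒮.colorDegree color c x : ℝ) ≤ ((n : ℝ) ^ (L - 1)) ^ (a + b) * Γ) :
    ((𝒮.incidences L).card : ℝ) ≤
      32 * Γ * (Fintype.card (Fin a ⊕ Fin b → Fin L → Fin n) *
        Real.logb 2 (Fintype.card (Fin a ⊕ Fin b → Fin L → Fin n))) := by
  classical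
  -- Four bad events (two colors, two ends) each take at most an eighth of the incidences, so half
  -- of them are good.
  set D := 8 * Γ with hD
  have hgood := card_good_le (𝒮 := 𝒮) (L := L) hc ht hno (D := D) (by positivity)
  set G := Finset.univ.filter fun s : (Fin a ⊕ Fin b → Fin L → Fin n) ×
        ((E × E) × (Fin a ⊕ Fin b → Fin L)) => 𝒮.Good color D s.2 s.1 with hG
  let B (f : ((E × E) × (Fin a ⊕ Fin b → Fin L)) → κ) :=
    (𝒮.incidences L).filter fun s => D < 𝒮.colorDegree color (f s.2) s.1
  let B' (f : ((E × E) × (Fin a ⊕ Fin b → Fin L)) → κ) :=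
    (𝒮.incidences L).filter fun s => D < 𝒮.colorDegree color (f s.2) (𝒮.move s.2 s.1)
  have hB : ∀ f, ((B f).card : ℝ) ≤ (𝒮.incidences L).card / 8 := by
    intro f
    have := card_filter_lt_colorDegree_le (D := D) hΓ f
    rw [hD, ← mul_assoc] at this
    have := le_of_mul_le_mul_right this hΓ0
    rw [le_div_iff₀ (by norm_num)]
    exact this
  -- Reversing the edge turns an excess at the far end into one at the near end.
  have hB' : ∀ f, (B' f).card ≤ (B fun l => f (rev l)).card := by
    intro f
    refine Finset.card_le_card_of_injOn (fun s => (𝒮.move s.2 s.1, rev s.2)) ?_ ?_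
    · rintro ⟨x, l⟩ h
      obtain ⟨h1, h2⟩ := Finset.mem_filter.1 h
      exact Finset.mem_coe.2 (Finset.mem_filter.2 ⟨Finset.mem_filter.2 ⟨Finset.mem_univ _,
        (Finset.mem_filter.1 h1).2.rev_move⟩, h2⟩)
    · rintro ⟨x, l⟩ h ⟨x', l'⟩ h' heq
      have h1 := (Finset.mem_filter.1 (Finset.mem_filter.1 h).1).2
      have h1' := (Finset.mem_filter.1 (Finset.mem_filter.1 h').1).2
      simp only [Prod.mk.injEq] at heq
      have hl : l = l' := by rw [← rev_rev l, heq.2, rev_rev]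
      subst hl
      have : x = x' := by
        have e := h1.move_rev_move
        rw [heq.1] at e
        exact e.symm.trans h1'.move_rev_move
      rw [this]
  have hcover : 𝒮.incidences L ⊆ G ∪ ((B fun l => color l.1.1) ∪ (B fun l => color l.1.2) ∪
      ((B' fun l => color l.1.1) ∪ (B' fun l => color l.1.2))) := by
    intro s hs
    by_contra hcon
    simp only [Finset.mem_union, not_or] at hcon
    obtain ⟨hng, ⟨h1, h2⟩, h3, h4⟩ := hcon
    simp only [B, B', Finset.mem_filter, hs, true_and, not_lt] at h1 h2 h3 h4
    refine hng (Finset.mem_filter.2 ⟨Finset.mem_univ _, (Finset.mem_filter.1 hs).2, ?_⟩)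
    rintro c (rfl | rfl)
    · exact ⟨h1, h3⟩
    · exact ⟨h2, h4⟩
  clear_value B B' G
  have hcard := (Finset.card_le_card hcover).trans ((Finset.card_union_le _ _).trans
    (Nat.add_le_add_left ((Finset.card_union_le _ _).trans (Nat.add_le_add
      (Finset.card_union_le _ _) ((Finset.card_union_le _ _).trans
        (Nat.add_le_add (hB' _) (hB' _))))) _))
  have hcard' : ((𝒮.incidences L).card : ℝ) ≤ _ := Nat.cast_le.2 hcard
  push_cast at hcard'
  have e1 := hB fun l => color l.1.1
  have e2 := hB fun l => color l.1.2
  have e3 := hB fun l => color (rev l).1.1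
  have e4 := hB fun l => color (rev l).1.2
  have : ((𝒮.incidences L).card : ℝ) ≤ 2 * G.card := by linarith
  refine this.trans ((mul_le_mul_of_nonneg_left hgood (by norm_num)).trans_eq ?_)
  rw [hD]
  ring

/-- Without a weakly rainbow even cover there are few pairs of hyperedges in the same star. -/
lemma card_starPairs_le (hc : H.IsProperColoring color) (ht : 0 < t) (hn : 0 < n) (hL : 0 < L)
    (hno : ∀ e, H.incidence e ∉ H.otherSpan color (color e)) {B : ℝ} (hB0 : 0 < B)
    (hB : ∀ c z I, ((𝒮.mixPairs color c z I).card : ℝ) ≤ B * ((L : ℝ) / n) ^ I.card) :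
    (𝒮.starPairs.card : ℝ) ≤ 32 * 2 ^ (a + b) * B * ((a + b) * L * Real.logb 2 n) := by
  have hn' : (0 : ℝ) < n := by exact_mod_cast hn
  have hL' : (0 : ℝ) < L := by exact_mod_cast hL
  have h := card_incidences_le (𝒮 := 𝒮) (L := L) hc ht hno
    (Γ := 2 ^ (a + b) * B * ((L : ℝ) / n) ^ (a + b)) (by positivity)
    (fun c p z => sum_colorDegree_le hn (hB c) p z)
  rw [card_incidences] at h
  have hN : (Fintype.card (Fin a ⊕ Fin b → Fin L → Fin n) : ℝ) =
      ((n : ℝ) ^ (L - 1)) ^ (a + b) * (n : ℝ) ^ (a + b) := by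
    rw [← mul_pow, ← pow_succ, Nat.sub_add_cancel hL]
    simp
  have hlog : Real.logb 2 (((n : ℝ) ^ (L - 1)) ^ (a + b) * (n : ℝ) ^ (a + b)) =
      (a + b) * L * Real.logb 2 n := by
    rw [← mul_pow, ← pow_succ, Nat.sub_add_cancel hL, ← pow_mul, Real.logb_pow]
    push_cast
    ring
  rw [hN, hlog, Finset.card_product, Finset.card_univ] at h
  simp only [Fintype.card_fun, Fintype.card_sum, Fintype.card_fin] at h
  push_cast at h
  -- This factor is common to both sides; only the logarithm of the number of points keeps a factor
  -- `L`.
  have hpos : (0 : ℝ) < ((n : ℝ) ^ (L - 1)) ^ (a + b) * (L : ℝ) ^ (a + b) := by positivity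
  refine le_of_mul_le_mul_right ?_ hpos
  refine le_trans (le_of_eq ?_) (h.trans (le_of_eq ?_))
  · ring
  · rw [div_pow]
    field_simp

end StarPartition

end MultiHypergraph

/-! ### Existence of star partitions and the lower bound on pairs. -/

namespace MultiHypergraph

lemma exists_starPartition {n : ℕ} {E : Type*} {H : MultiHypergraph n E} {q t a b p : ℕ}
    (hu : H.IsUniform q) (hab : a + b = q - t) {part : E → Fin p} {Q : Fin p → Finset (Fin n)}
    (hQ : ∀ θ, (Q θ).card = t) (hsub : ∀ e, Q (part e) ⊆ H.verts e) :
    ∃ 𝒮 : H.StarPartition t (Fin a ⊕ Fin b), ∀ e f, 𝒮.part e = 𝒮.part f ↔ part e = part f := by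
  have h : ∀ e, ∃ g : Fin a ⊕ Fin b → Fin n, Function.Injective g ∧
      Finset.univ.image g = H.verts e \ Q (part e) := by
    intro e
    have hcard : (H.verts e \ Q (part e)).card = a + b := by
      rw [Finset.card_sdiff_of_subset (hsub e), hu, hQ, hab]
    let φ : Fin a ⊕ Fin b ≃ (H.verts e \ Q (part e) : Finset (Fin n)) :=
      finSumFinEquiv.trans (Finset.equivFinOfCardEq hcard).symm
    refine ⟨fun i => φ i, Subtype.val_injective.comp φ.injective, ?_⟩
    ext v
    rw [Finset.mem_image]
    constructor
    · rintro ⟨i, -, rfl⟩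
      exact (φ i).2
    · intro hv
      exact ⟨φ.symm ⟨v, hv⟩, Finset.mem_univ _, by simp⟩
  choose g hg hg' using h
  exact ⟨⟨p, part, Q, hQ, hsub, g, hg, hg'⟩, fun _ _ => Iff.rfl⟩

/-- The `1` in `hd` accounts for the hyperedge itself, which is no partner of its own. -/
lemma StarPartition.mul_le_card_starPairs {n : ℕ} {E : Type*} [Fintype E] [DecidableEq E]
    {H : MultiHypergraph n E} {t a b : ℕ} (𝒮 : H.StarPartition t (Fin a ⊕ Fin b)) {d : ℝ}
    (hd : ∀ e, d + 1 ≤ ((Finset.univ.filter fun f => 𝒮.part e = 𝒮.part f).card : ℝ)) :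
    Fintype.card E * d ≤ 𝒮.starPairs.card := by
  rw [Finset.card_eq_sum_card_fiberwise (f := Prod.fst) (t := Finset.univ) (by simp)]
  push_cast
  rw [← Finset.card_univ, ← nsmul_eq_mul]
  refine Finset.card_nsmul_le_sum _ _ _ fun e _ => ?_
  have h1 : ((Finset.univ.filter fun f => 𝒮.part e = 𝒮.part f).erase e).card ≤
      (𝒮.starPairs.filter fun P => P.1 = e).card := by
    refine Finset.card_le_card_of_injOn (fun f => (e, f)) ?_ ?_
    · intro f hf
      obtain ⟨h1, h2⟩ := Finset.mem_erase.1 hf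
      exact Finset.mem_coe.2 (Finset.mem_filter.2 ⟨Finset.mem_filter.2
        ⟨Finset.mem_univ _, (Finset.mem_filter.1 h2).2, h1.symm⟩, rfl⟩)
    · intro f _ f' _ h
      exact (Prod.mk.inj h).2
  have h2 := Finset.card_erase_add_one (s := Finset.univ.filter fun f => 𝒮.part e = 𝒮.part f)
    (a := e) (by simp)
  have h3 : (((Finset.univ.filter fun f => 𝒮.part e = 𝒮.part f).erase e).card : ℝ) + 1 =
      (Finset.univ.filter fun f => 𝒮.part e = 𝒮.part f).card := by exact_mod_cast h2
  have h4 : (((Finset.univ.filter fun f => 𝒮.part e = 𝒮.part f).erase e).card : ℝ) ≤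
      (𝒮.starPairs.filter fun P => P.1 = e).card := by exact_mod_cast h1
  linarith [hd e]

lemma avgDegree_le_maxCodegree_one {n : ℕ} {E : Type*} [Fintype E] (H : MultiHypergraph n E)
    (hn : 0 < n) : H.avgDegree ≤ H.maxCodegree 1 := by
  rw [avgDegree, div_le_iff₀ (by exact_mod_cast hn)]
  refine (Finset.sum_le_card_nsmul _ _ (H.maxCodegree 1 : ℝ) fun v _ =>
    Nat.cast_le.2 (H.degree_le_maxCodegree_one v)).trans_eq ?_
  simp [mul_comm]

end MultiHypergraph

/-! ### Consequences of goodness. -/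

section Numerics

variable {n q t : ℕ} {d : ℕ → ℝ}

/-- For odd `q` one of the two alternatives of the third goodness condition applies. Below `q / 2`
the exponents add up to `(q - 2t) / q ≥ 0`, above it to zero. -/
lemma IsGoodIndex.le_of_le (h : IsGoodIndex n q d t) (hn : 2 ≤ n) (hq : Odd q) {x : ℝ}
    (hx : 0 ≤ x) (hd : x * (n : ℝ) ^ (1 - 2 / (q : ℝ)) ≤ d 1) : x ≤ d t := by
  have hq0 : (0 : ℝ) < q := by exact_mod_cast hq.pos
  have hn1 : (1 : ℝ) ≤ n := by exact_mod_cast (by omega : 1 ≤ n)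
  have hn0 : (0 : ℝ) < n := by linarith
  have hne : (t : ℝ) ≠ (q : ℝ) / 2 := by
    intro heq
    have : 2 * t = q := by
      have : (2 : ℝ) * t = q := by linarith
      exact_mod_cast this
    obtain ⟨k, hk⟩ := hq
    omega
  rcases lt_or_gt_of_ne hne with hlt | hgt
  · refine le_trans ?_ ((mul_le_mul_of_nonneg_right hd (by positivity)).trans (h.2.2.1 hlt))
    rw [mul_assoc, ← Real.rpow_add hn0]
    refine le_mul_of_one_le_right hx (Real.one_le_rpow hn1 ?_)
    have : 1 - 2 / (q : ℝ) + -(2 / (q : ℝ)) * ((t : ℝ) - 1) = (q - 2 * t) / q := by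
      field_simp
      ring
    rw [this]
    exact div_nonneg (by linarith) hq0.le
  · refine le_trans ?_ ((mul_le_mul_of_nonneg_right hd (by positivity)).trans (h.2.2.2 hgt))
    rw [mul_assoc, ← Real.rpow_add hn0]
    simp

lemma IsGoodIndex.le_mul_pow (h : IsGoodIndex n q d t) (hn : 0 < n) (hd : 0 < d t) {l : ℝ}
    (hl : (n : ℝ) ^ (-(2 / (q : ℝ))) ≤ l) {j : ℕ} (h1 : 1 ≤ j) (hj : j ≤ (q - t + 1) / 2) :
    d j ≤ n * d t * l ^ j := by
  have hn0 : (0 : ℝ) < n := by exact_mod_cast hn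
  have := h.1 j h1 hj
  rw [div_le_iff₀ hd] at this
  refine this.trans ?_
  have e : (n : ℝ) ^ (1 - 2 * (j : ℝ) / q) = n * ((n : ℝ) ^ (-(2 / (q : ℝ)))) ^ j := by
    rw [← Real.rpow_natCast, ← Real.rpow_mul hn0.le]
    nth_rewrite 2 [← Real.rpow_one (n : ℝ)]
    rw [← Real.rpow_add hn0]
    congr 1
    ring
  rw [e]
  have : ((n : ℝ) ^ (-(2 / (q : ℝ)))) ^ j ≤ l ^ j := pow_le_pow_left₀ (by positivity) hl j
  calc _ ≤ n * l ^ j * d t := by gcongr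
    _ = _ := by ring

/-- As `q` is odd, `a = (q - t + 1) / 2` satisfies `1 - 2a/q = (t - 1(t even)) / q`, which is the
extra exponent in the second goodness condition. -/
lemma IsGoodIndex.add_le_mul_pow (h : IsGoodIndex n q d t) (hq : Odd q) (htq : t ≤ q) (hn : 0 < n)
    (hd : 0 < d t) {l : ℝ} (hl : (n : ℝ) ^ (-(2 / (q : ℝ))) ≤ l) {j : ℕ}
    (hj : j ≤ (q - t) / 2) :
    d (t + j) ≤ n * d t * l ^ ((q - t + 1) / 2 + j) := by
  have hn0 : (0 : ℝ) < n := by exact_mod_cast hn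
  have hq0 : (0 : ℝ) < q := by exact_mod_cast hq.pos
  have := h.2.1 (t + j) (by omega) (by omega)
  rw [div_le_iff₀ hd] at this
  refine this.trans ?_
  have ha : (((q - t + 1) / 2 : ℕ) : ℝ) = (q - t + if Even t then 1 else 0) / 2 := by
    rw [eq_div_iff two_ne_zero]
    obtain ⟨k, hk⟩ := hq
    split_ifs with ht
    · obtain ⟨m, hm⟩ := ht
      have : (q - t + 1) / 2 * 2 + t = q + 1 := by omega
      have : (((q - t + 1) / 2 : ℕ) : ℝ) * 2 + t = q + 1 := by exact_mod_cast this
      linarith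
    · obtain ⟨m, hm⟩ := Nat.not_even_iff_odd.1 ht
      have : (q - t + 1) / 2 * 2 + t = q := by omega
      have : (((q - t + 1) / 2 : ℕ) : ℝ) * 2 + t = q := by exact_mod_cast this
      linarith
  have e : (n : ℝ) ^ (-(2 / (q : ℝ)) * (((t + j : ℕ) : ℝ) - t) +
      1 / (q : ℝ) * ((t : ℝ) - if Even t then 1 else 0)) =
      n * ((n : ℝ) ^ (-(2 / (q : ℝ)))) ^ ((q - t + 1) / 2 + j) := by
    rw [← Real.rpow_natCast, ← Real.rpow_mul hn0.le]
    nth_rewrite 2 [← Real.rpow_one (n : ℝ)]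
    rw [← Real.rpow_add hn0]
    congr 1
    push_cast [ha]
    field_simp
    ring
  rw [e]
  have : ((n : ℝ) ^ (-(2 / (q : ℝ)))) ^ ((q - t + 1) / 2 + j) ≤ l ^ ((q - t + 1) / 2 + j) :=
    pow_le_pow_left₀ (by positivity) hl _
  calc _ ≤ n * l ^ ((q - t + 1) / 2 + j) * d t := by gcongr
    _ = _ := by ring

end Numerics

/-! ### Choice of parameters and conclusion. -/

theorem lemma2p6 (q : ℕ) (hq : Odd q) :
    ∃ A : ℝ, 0 < A ∧
      ∀ (t : ℕ), 1 ≤ t → t ≤ q →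
      ∀ (n : ℕ), 2 ≤ n →
      ∀ (E : Type*) [Fintype E] (κ : Type*) (H : MultiHypergraph n E) (color : E → κ),
        H.IsUniform q →
        H.IsProperColoring color →
        H.IsApproxStronglyRegular q t →
        A * (n : ℝ) ^ (1 - 2 / (q : ℝ)) * Real.log n ≤ H.avgDegree →
        ∃ S : Finset E, H.IsWeaklyRainbowEvenCover color S := by
  have hq1 : 1 ≤ q := hq.pos
  have hqR : (1 : ℝ) ≤ q := by exact_mod_cast hq1
  -- Twice the constant reached in `hfin`.
  refine ⟨2 ^ (q + 11) * q ^ 2, by positivity, ?_⟩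
  intro t ht htq n hn E _ κ H color hu hc hreg havg
  classical
  by_contra hS
  have hno : ∀ e, H.incidence e ∉ H.otherSpan color (color e) := fun e he =>
    hS (MultiHypergraph.exists_weaklyRainbow_of_mem_otherSpan he)
  obtain ⟨⟨p, part, Q, hQ, hsub, hpart⟩, hgood⟩ := hreg
  have hn0 : (0 : ℝ) < n := by exact_mod_cast (by omega : 0 < n)
  have hn1 : (1 : ℝ) ≤ n := by exact_mod_cast (by omega : 1 ≤ n)
  have hlog : 1 / 2 ≤ Real.log n := by
    refine le_trans ?_ (Real.log_le_log (by norm_num) (by exact_mod_cast hn : (2 : ℝ) ≤ n))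
    linarith [Real.log_two_gt_d9]
  have hd1 := havg.trans (H.avgDegree_le_maxCodegree_one (by omega))
  have hA : (8 : ℝ) ≤ 2 ^ (q + 11) * q ^ 2 := by
    have h1 : (2 : ℝ) ^ 3 ≤ 2 ^ (q + 11) := pow_le_pow_right₀ (by norm_num) (by omega)
    have h2 : (1 : ℝ) ≤ (q : ℝ) ^ 2 := one_le_pow₀ hqR
    nlinarith
  -- This makes `d_t / 2 ≥ d_t / 4 + 1`, so a star stays large after one hyperedge is removed.
  have hdt : (4 : ℝ) ≤ H.maxCodegree t := by
    refine hgood.le_of_le hn hq (by norm_num) (le_trans ?_ hd1)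
    rw [mul_right_comm]
    refine mul_le_mul_of_nonneg_right ?_ (by positivity)
    nlinarith
  set x : ℝ := (n : ℝ) ^ (1 - 2 / (q : ℝ)) with hx
  have hx0 : 0 < x := Real.rpow_pos_of_pos hn0 _
  -- The least length with `L / n ≥ n^(-2/q)`, the cost per vertex that goodness allows.
  set L : ℕ := ⌈x⌉₊ with hL
  have hL0 : 0 < L := Nat.ceil_pos.2 hx0
  have hLn : L ≤ n := by
    refine Nat.ceil_le.2 ?_
    refine (Real.rpow_le_rpow_of_exponent_le hn1 (y := 1 - 2 / (q : ℝ)) (z := 1) ?_).trans_eq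
      (Real.rpow_one _)
    have : 0 ≤ 2 / (q : ℝ) := by positivity
    linarith
  have hl : (n : ℝ) ^ (-(2 / (q : ℝ))) ≤ (L : ℝ) / n := by
    rw [le_div_iff₀ hn0]
    refine le_trans (le_of_eq ?_) (Nat.le_ceil x)
    rw [hx, sub_eq_neg_add, Real.rpow_add hn0, Real.rpow_one]
  have hl1 : (L : ℝ) / n ≤ 1 := by
    rw [div_le_one hn0]
    exact_mod_cast hLn
  obtain ⟨𝒮, h𝒮⟩ := MultiHypergraph.exists_starPartition (a := (q - t + 1) / 2) (b := (q - t) / 2)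
    hu (by omega) hQ hsub
  have hpairs := 𝒮.mul_le_card_starPairs (d := H.maxCodegree t / 4) (by
    intro e
    have h1 := (hpart (part e)).1
    have h2 : (Finset.univ.filter fun f => 𝒮.part e = 𝒮.part f) =
        Finset.univ.filter fun f => part f = part e :=
      Finset.filter_congr fun f _ => (h𝒮 e f).trans eq_comm
    rw [h2]
    linarith)
  have hdt0 : (0 : ℝ) < H.maxCodegree t := by linarith
  have hub := 𝒮.card_starPairs_le (color := color) (L := L) hc ht (by omega) hL0 hno
    (B := 2 * (n * H.maxCodegree t)) (by positivity)
    (fun c z I => MultiHypergraph.StarPartition.card_mixPairs_le_mul_pow hc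
      (fun e => Finset.card_pos.1 (by rw [hu]; omega)) ht (by omega) (by omega)
      (by positivity) hl1
      (fun j h1 hj => hgood.le_mul_pow (by omega) hdt0 hl h1 hj)
      (fun j hj => hgood.add_le_mul_pow hq htq (by omega) hdt0 hl hj))
  have hab : (((q - t + 1) / 2 : ℕ) : ℝ) + (((q - t) / 2 : ℕ) : ℝ) = ((q - t : ℕ) : ℝ) := by
    exact_mod_cast (by omega : (q - t + 1) / 2 + (q - t) / 2 = q - t)
  rw [hab, show (q - t + 1) / 2 + (q - t) / 2 = q - t by omega] at hub
  -- Here `2 ^ 8` is `32 * 2 * 4`: from the pair bound, from `B`, and from `d_t / 4`.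
  have hm : (Fintype.card E : ℝ) ≤ 2 ^ 8 * 2 ^ (q - t) * n * ((q - t : ℕ) * L * Real.logb 2 n) := by
    have := hpairs.trans hub
    refine le_of_mul_le_mul_right ?_ (by positivity : (0 : ℝ) < H.maxCodegree t / 4)
    refine this.trans (le_of_eq ?_)
    ring
  have hsL : ((q - t : ℕ) : ℝ) * L ≤ q * (2 * x) := by
    -- For `q = 1` rounding up can more than double `x`, but then `q - t = 0`. Otherwise `q ≥ 2`
    -- gives `x ≥ 1`.
    rcases Nat.eq_zero_or_pos (q - t) with h0 | h0
    · rw [h0]; simp; positivity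
    · have hq2 : (2 : ℝ) ≤ q := by exact_mod_cast (by omega : 2 ≤ q)
      have hx1 : 1 ≤ x := Real.one_le_rpow hn1 (by
        have : 2 / (q : ℝ) ≤ 1 := by rw [div_le_one (by linarith)]; exact hq2
        linarith)
      have h1 : (L : ℝ) ≤ 2 * x := by
        have := Nat.ceil_lt_add_one hx0.le
        linarith
      have h2 : ((q - t : ℕ) : ℝ) ≤ q := by exact_mod_cast Nat.sub_le q t
      exact mul_le_mul h2 h1 (by positivity) (by positivity)
  have hlogb : Real.logb 2 n ≤ 2 * Real.log n := by
    rw [Real.logb, div_le_iff₀ (Real.log_pos (by norm_num))]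
    nlinarith [Real.log_two_gt_d9]
  have hlogb0 : 0 ≤ Real.logb 2 n := Real.logb_nonneg (by norm_num) hn1
  have havg' : H.avgDegree = q * Fintype.card E / n := by
    rw [MultiHypergraph.avgDegree]
    congr 1
    exact_mod_cast H.sum_degree hu
  have hfin : H.avgDegree ≤ 2 ^ (q + 10) * q ^ 2 * x * Real.log n := by
    rw [havg', div_le_iff₀ hn0]
    calc (q : ℝ) * Fintype.card E
        ≤ q * (2 ^ 8 * 2 ^ (q - t) * n * ((q - t : ℕ) * L * Real.logb 2 n)) := by gcongr
      _ ≤ q * (2 ^ 8 * 2 ^ q * n * (q * (2 * x) * (2 * Real.log n))) := by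
          gcongr
          · norm_num
          · exact Nat.sub_le q t
      _ = _ := by ring
  have hpos : 0 < 2 ^ (q + 10) * (q : ℝ) ^ 2 * x * Real.log n := by positivity
  have : (2 : ℝ) ^ (q + 11) * q ^ 2 * x * Real.log n =
      2 * (2 ^ (q + 10) * q ^ 2 * x * Real.log n) := by ring
  linarith
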